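/- Let $d,n\ge 1$ be integers, let $A:\mathbb R^d\to\mathbb R^d$ and $B:\mathbb R^n\to\mathbb R^d$ be linear maps, let $F:\mathbb R^d\to\mathbb R^d$ be smooth and globally Lipschitz, and let $(W_t)_{t\ge 0}$ be a Wiener process in $\mathbb R^n$ on a probability space $(\Omega,\mathcal F,\mathbf P)$. For $x\in\mathbb R^d$ let $(X_t(x))_{t\ge 0}$ be the (unique) continuous solution of $$X_t(x)=x+\int_0^t \big(A X_s(x)+F(X_s(x))\big)\,ds+B W_t ,\qquad t\ge 0,$$ and let $P_T(x,\cdot)$ denote the distribution of the random variable $X_T(x)$. Suppose that: (K) the columns of $B, AB, A^2B,\dots$ span $\mathbb R^d$; let $d_*$ be an integer such that already $\operatorname{span}\{A^kBe_i : 0\le k<d_*,\ 1\le i\le n\}=\mathbb R^d$, where $e_1,\dots,e_n$ is the standard basis of $\mathbb R^n$; (G) there is $a\in[0,\tfrac1{2d_*})$ such that $\displaystyle\sup_{x\in\mathbb R^d}\frac{|F(x)|}{(1+|x|)^a}<\infty$. Then, for every $x_0\in\mathbb R^d$ and $\delta>0$, with $B(x_0,\delta)$ the open Euclidean ball of radius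 $\delta$ centred at $x_0$, the function $$(x,T)\mapsto P_T(x,B(x_0,\delta))$$ is strictly positive on $\mathbb R^d\times(0,\infty)$ and jointly lower semicontinuous on $\mathbb R^d\times[0,\infty)$. -/

import Mathlib

open MeasureTheory ProbabilityTheory
open scoped NNReal ENNReal

namespace LangevinSDE

section Integral

variable {E : Type*} [NormedAddCommGroup E] [NormedSpace ℝ E] [CompleteSpace E]

/-- A Volterra equation with globally Lipschitz `G` and continuous forcing `w` has a continuous
solution on `[0, ∞)`. -/
theorem exists_volterra {K : ℝ≥0} {G : E → E} (hG : LipschitzWith K G) {w : ℝ≥0 → E}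
    (hw : Continuous w) :
    ∃ y : ℝ≥0 → E, Continuous y ∧
      ∀ t : ℝ≥0, y t = w t + ∫ s in (0 : ℝ)..t, G (y s.toNNReal) := by
  have hGc := hG.continuous
  set g : ℝ → ℝ := fun s => ‖G (w s.toNNReal)‖ with hg
  have hgc : Continuous g := by fun_prop
  set l : ℝ := 2 * K + 1 with hl
  have hl0 : 0 < l := by positivity
  set q : ℝ → ℝ := fun t => 1 + ∫ s in (0 : ℝ)..t, g s with hq
  have hqc : Continuous q :=
    continuous_const.add (intervalIntegral.continuous_primitive
      (fun a b => hgc.intervalIntegrable a b) 0)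
  have hq1 : ∀ t, 0 ≤ t → 1 ≤ q t := fun t ht => by
    have : 0 ≤ ∫ s in (0 : ℝ)..t, g s :=
      intervalIntegral.integral_nonneg ht fun s _ => norm_nonneg _
    simp only [hq]; linarith
  have hqm : ∀ s t, 0 ≤ s → s ≤ t → q s ≤ q t := fun s t hs hst => by
    have h1 := intervalIntegral.integral_add_adjacent_intervals
      (hgc.intervalIntegrable (μ := volume) 0 s) (hgc.intervalIntegrable s t)
    have : 0 ≤ ∫ u in s..t, g u :=
      intervalIntegral.integral_nonneg hst fun s _ => norm_nonneg _
    simp only [hq]; linarith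
  set p : ℝ → ℝ := fun t => Real.exp (l * t) * q t with hp
  have hpc : Continuous p := by fun_prop
  have hp1 : ∀ t, 0 ≤ t → 0 < p t := fun t ht =>
    mul_pos (Real.exp_pos _) (by linarith [hq1 t ht])
  have hqp : ∀ t, 0 ≤ t → q t ≤ p t := fun t ht => by
    have h1 : 1 ≤ Real.exp (l * t) := Real.one_le_exp (by positivity)
    have := hq1 t ht
    simp only [hp]; nlinarith
  have hpi : ∀ t, 0 ≤ t → ∫ s in (0 : ℝ)..t, p s ≤ p t / l := fun t ht => by
    have h1 : ∫ s in (0 : ℝ)..t, p s ≤ ∫ s in (0 : ℝ)..t, Real.exp (l * s) * q t := by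
      refine intervalIntegral.integral_mono_on ht (hpc.intervalIntegrable _ _)
        (Continuous.intervalIntegrable (by fun_prop) _ _) fun s hs => ?_
      exact mul_le_mul_of_nonneg_left (hqm s t hs.1 hs.2) (Real.exp_pos _).le
    have h2 : ∫ s in (0 : ℝ)..t, Real.exp (l * s) * q t
        = l⁻¹ * (Real.exp (l * t) - 1) * q t := by
      rw [intervalIntegral.integral_mul_const,
        intervalIntegral.integral_comp_mul_left (fun s => Real.exp s) hl0.ne']
      simp
    rw [h2] at h1
    refine h1.trans ?_
    rw [div_eq_inv_mul, mul_assoc]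
    refine mul_le_mul_of_nonneg_left ?_ (by positivity)
    have := hq1 t ht
    simp only [hp]; nlinarith
  -- integrand and Picard map for the rescaled unknown `u = (y - w) / p`
  let I : BoundedContinuousFunction ℝ≥0 E → ℝ → E :=
    fun u s => G (p s • u s.toNNReal + w s.toNNReal)
  have hIc : ∀ u, Continuous (I u) := fun u => by
    have := u.continuous
    simp only [I]; fun_prop
  let J : BoundedContinuousFunction ℝ≥0 E → ℝ≥0 → E :=
    fun u t => (p t)⁻¹ • ∫ s in (0 : ℝ)..t, I u s
  have hJc : ∀ u, Continuous (J u) := fun u => by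
    have h1 : Continuous fun b : ℝ => ∫ s in (0 : ℝ)..b, I u s :=
      intervalIntegral.continuous_primitive (fun a b => (hIc u).intervalIntegrable a b) 0
    have h2 : Continuous fun t : ℝ≥0 => (p t)⁻¹ :=
      (hpc.comp NNReal.continuous_coe).inv₀ fun t => (hp1 t t.2).ne'
    exact h2.smul (h1.comp NNReal.continuous_coe)
  have hdiff : ∀ u v (t : ℝ≥0), ‖J u t - J v t‖ ≤ (K / l) * ‖u - v‖ := fun u v t => by
    have hb : ‖∫ s in (0 : ℝ)..t, (I u s - I v s)‖
        ≤ ∫ s in (0 : ℝ)..t, p s * (K * ‖u - v‖) := by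
      refine intervalIntegral.norm_integral_le_of_norm_le t.2 (Filter.Eventually.of_forall ?_)
        (Continuous.intervalIntegrable (by fun_prop) _ _)
      intro s hs
      have h1 := hG.norm_sub_le (p s • u s.toNNReal + w s.toNNReal)
        (p s • v s.toNNReal + w s.toNNReal)
      have h2 := (u - v).norm_coe_le_norm s.toNNReal
      have h3 := hp1 s hs.1.le
      rw [add_sub_add_right_eq_sub, ← smul_sub, norm_smul, Real.norm_of_nonneg h3.le] at h1
      refine h1.trans ?_
      simp only [BoundedContinuousFunction.coe_sub, Pi.sub_apply] at h2
      calc (K : ℝ) * (p s * ‖u s.toNNReal - v s.toNNReal‖)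
          ≤ K * (p s * ‖u - v‖) := by gcongr
        _ = p s * (K * ‖u - v‖) := by ring
    rw [intervalIntegral.integral_mul_const] at hb
    have h3 := hp1 t t.2
    have h4 := hpi t t.2
    simp only [J]
    rw [← smul_sub, ← intervalIntegral.integral_sub ((hIc u).intervalIntegrable _ _)
      ((hIc v).intervalIntegrable _ _), norm_smul, norm_inv, Real.norm_of_nonneg h3.le]
    calc (p t)⁻¹ * ‖∫ s in (0 : ℝ)..t, (I u s - I v s)‖
        ≤ (p t)⁻¹ * (p t / l * (K * ‖u - v‖)) := by
          refine mul_le_mul_of_nonneg_left (hb.trans ?_) (by positivity)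
          gcongr
      _ = (K / l) * ‖u - v‖ := by field_simp
  have h0 : ∀ t : ℝ≥0, ‖J 0 t‖ ≤ 1 := fun t => by
    have h3 := hp1 t t.2
    have hb : ‖∫ s in (0 : ℝ)..t, I 0 s‖ ≤ ∫ s in (0 : ℝ)..t, g s := by
      refine intervalIntegral.norm_integral_le_of_norm_le t.2 (Filter.Eventually.of_forall ?_)
        (hgc.intervalIntegrable _ _)
      intro s hs
      simp [I, hg]
    have h4 := hqp t t.2
    simp only [J]
    rw [norm_smul, norm_inv, Real.norm_of_nonneg h3.le, inv_mul_le_iff₀ h3]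
    simp only [hq] at h4
    linarith
  let Φ : BoundedContinuousFunction ℝ≥0 E → BoundedContinuousFunction ℝ≥0 E := fun u =>
    BoundedContinuousFunction.ofNormedAddCommGroup (J u) (hJc u) ((K / l) * ‖u - 0‖ + 1)
      fun t => by
        have h1 := hdiff u 0 t
        have h2 := norm_le_norm_add_norm_sub' (J u t) (J 0 t)
        linarith [h0 t]
  have hKl : (K : ℝ) / l ≤ 1 / 2 := by
    rw [div_le_iff₀ hl0]; simp only [hl]; linarith
  have hΦ : ContractingWith (1 / 2) Φ := by
    refine ⟨by norm_num, LipschitzWith.of_dist_le_mul fun u v => ?_⟩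
    rw [BoundedContinuousFunction.dist_le (by positivity)]
    intro t
    rw [dist_eq_norm, dist_eq_norm]
    refine (hdiff u v t).trans ?_
    have : (((1 / 2 : ℝ≥0)) : ℝ) = 1 / 2 := by norm_num
    rw [this]
    gcongr
  obtain ⟨u, hu⟩ : ∃ u, Φ u = u := ⟨_, hΦ.fixedPoint_isFixedPt⟩
  have hu' : ∀ t, J u t = u t := fun t => by
    conv_rhs => rw [← hu]
    rfl
  refine ⟨fun t => p t • u t + w t, ?_, fun t => ?_⟩
  · have := u.continuous
    fun_prop
  · have h3 := hp1 t t.2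
    have h5 : p t • u t = ∫ s in (0 : ℝ)..t, I u s := by
      rw [← hu' t]; simp only [J]; rw [smul_inv_smul₀ h3.ne']
    change p t • u t + w t = _
    rw [add_comm, h5]
    congr 1
    refine intervalIntegral.integral_congr fun s hs => ?_
    rw [Set.uIcc_of_le (show (0 : ℝ) ≤ t from t.2)] at hs
    simp only [I, Real.coe_toNNReal s hs.1]

/-- Continuous solutions of such a Volterra equation are unique. -/
theorem unique_volterra {K : ℝ≥0} {G : E → E} (hG : LipschitzWith K G) {w : ℝ≥0 → E}
    {y z : ℝ≥0 → E} (hy : Continuous y) (hz : Continuous z)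
    (hy' : ∀ t : ℝ≥0, y t = w t + ∫ s in (0 : ℝ)..t, G (y s.toNNReal))
    (hz' : ∀ t : ℝ≥0, z t = w t + ∫ s in (0 : ℝ)..t, G (z s.toNNReal)) : y = z := by
  have hGc := hG.continuous
  have key : ∀ v : ℝ≥0 → E, Continuous v →
      (∀ t : ℝ≥0, v t = w t + ∫ s in (0 : ℝ)..t, G (v s.toNNReal)) → ∀ t : ℝ, 0 ≤ t →
      HasDerivAt (fun r : ℝ => ∫ s in (0 : ℝ)..r, G (v s.toNNReal))
        (G ((∫ s in (0 : ℝ)..t, G (v s.toNNReal)) + w t.toNNReal)) t := by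
    intro v hv hv' t ht
    have hc : Continuous fun s : ℝ => G (v s.toNNReal) := by fun_prop
    have h1 := intervalIntegral.integral_hasDerivAt_right (hc.intervalIntegrable 0 t)
      (hc.stronglyMeasurableAtFilter _ _) hc.continuousAt
    have h2 := hv' t.toNNReal
    rw [Real.coe_toNNReal t ht] at h2
    rw [h2, add_comm] at h1
    exact h1
  funext t
  have := ODE_solution_unique (v := fun (s : ℝ) e => G (e + w s.toNNReal)) (K := K)
    (f := fun r : ℝ => ∫ s in (0 : ℝ)..r, G (y s.toNNReal))
    (g := fun r : ℝ => ∫ s in (0 : ℝ)..r, G (z s.toNNReal)) (a := 0) (b := t)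
    (fun s => by
      intro a b
      simpa using hG (a + w s.toNNReal) (b + w s.toNNReal))
    (intervalIntegral.continuous_primitive
      (fun a b => Continuous.intervalIntegrable (by fun_prop) a b) 0).continuousOn
    (fun s hs => (key y hy hy' s hs.1).hasDerivWithinAt)
    (intervalIntegral.continuous_primitive
      (fun a b => Continuous.intervalIntegrable (by fun_prop) a b) 0).continuousOn
    (fun s hs => (key z hz hz' s hs.1).hasDerivWithinAt)
    (by simp) ⟨t.2, le_refl _⟩
  rw [hy' t, hz' t]
  exact congrArg _ this

end Integral

/-- `ℝ^d` with its Euclidean norm. -/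
abbrev Vec (d : ℕ) : Type := EuclideanSpace ℝ (Fin d)

/-- The span of the vectors `A ^ k (B e_i)`, `k < m`, where `e_i` is the standard basis. -/
noncomputable def kalmanSpan {d n : ℕ} (A : Vec d →L[ℝ] Vec d) (B : Vec n →L[ℝ] Vec d) (m : ℕ) :
    Submodule ℝ (Vec d) :=
  Submodule.span ℝ {v | ∃ k < m, ∃ i : Fin n, v = (A ^ k) (B (EuclideanSpace.single i 1))}

/-- Kalman condition: the columns of `B`, `A B`, `A² B`, … span `ℝ^d`. -/
def KalmanCondition {d n : ℕ} (A : Vec d →L[ℝ] Vec d) (B : Vec n →L[ℝ] Vec d) : Prop :=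
  Submodule.span ℝ {v | ∃ (k : ℕ) (i : Fin n), v = (A ^ k) (B (EuclideanSpace.single i 1))} = ⊤

/-- Growth condition relative to `m`: `sup_x |F x| / (1 + |x|)^a < ∞` for some
`a ∈ [0, 1 / (2 m))`. -/
def GrowthCondition {d : ℕ} (F : Vec d → Vec d) (m : ℕ) : Prop :=
  ∃ a : ℝ, 0 ≤ a ∧ a < 1 / (2 * (m : ℝ)) ∧
    BddAbove (Set.range fun x : Vec d => ‖F x‖ / (1 + ‖x‖) ^ a)

/-- A Wiener process in `ℝ^n`: the coordinates are independent real Brownian motions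
(started at `0`, with almost surely continuous paths). -/
structure IsWiener {Ω : Type*} [MeasurableSpace Ω] (P : Measure Ω) {n : ℕ}
    (W : ℝ≥0 → Ω → Vec n) : Prop where
  coord : ∀ i : Fin n, IsBrownianReal (fun t ω => W t ω i) P
  indep : iIndepFun (fun (i : Fin n) (ω : Ω) (t : ℝ≥0) => W t ω i) P

/-- `y` is a continuous solution on `[0, ∞)` of
`y(t) = x + ∫₀ᵗ (A y(s) + F (y(s))) ds + B η(t)`. -/
def IsSolution {d n : ℕ} (A : Vec d →L[ℝ] Vec d) (F : Vec d → Vec d) (B : Vec n →L[ℝ] Vec d)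
    (x : Vec d) (η : ℝ≥0 → Vec n) (y : ℝ≥0 → Vec d) : Prop :=
  Continuous y ∧ ∀ t : ℝ≥0,
    y t = x + (∫ s in (0 : ℝ)..t, (A (y s.toNNReal) + F (y s.toNNReal))) + B (η t)

open Classical in
/-- The solution at time `t` of the integral equation with initial condition `x` and driving
path `η`. For Lipschitz `F` and continuous `η` it is the unique one, see
`isSolution_solution` and `IsSolution.eq_solution`; the value for other `η` is irrelevant. -/
noncomputable def solution {d n : ℕ} (A : Vec d →L[ℝ] Vec d) (F : Vec d → Vec d)
    (B : Vec n →L[ℝ] Vec d) (x : Vec d) (η : ℝ≥0 → Vec n) : ℝ≥0 → Vec d :=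
  if h : ∃ y, IsSolution A F B x η y then h.choose else 0

/-- The distribution `P_T(x, ·)` of the value at time `T` of the solution of
`dX = (A X + F X) dt + B dW`, `X_0 = x`. -/
noncomputable def transition {Ω : Type*} [MeasurableSpace Ω] (P : Measure Ω) {d n : ℕ}
    (W : ℝ≥0 → Ω → Vec n) (A : Vec d →L[ℝ] Vec d) (F : Vec d → Vec d) (B : Vec n →L[ℝ] Vec d)
    (T : ℝ≥0) (x : Vec d) : Measure (Vec d) :=
  P.map fun ω => solution A F B x (fun t => W t ω) T

section Solution

variable {d n : ℕ} {A : Vec d →L[ℝ] Vec d} {F : Vec d → Vec d} {B : Vec n →L[ℝ] Vec d}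
  {x : Vec d} {η : ℝ≥0 → Vec n}

theorem isSolution_solution (hF : ∃ K, LipschitzWith K F) (hη : Continuous η) :
    IsSolution A F B x η (solution A F B x η) := by
  obtain ⟨K, hK⟩ := hF
  have hex : ∃ y, IsSolution A F B x η y := by
    obtain ⟨y, hy, hy'⟩ := exists_volterra (A.lipschitz.add hK)
      (w := fun t => x + B (η t)) (by fun_prop)
    refine ⟨y, hy, fun t => ?_⟩
    rw [hy' t]
    abel
  rw [solution, dif_pos hex]
  exact hex.choose_spec

theorem IsSolution.eq_solution (hF : ∃ K, LipschitzWith K F) (hη : Continuous η)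
    {y : ℝ≥0 → Vec d} (hy : IsSolution A F B x η y) : y = solution A F B x η := by
  have hz := isSolution_solution (A := A) (B := B) (x := x) hF hη
  obtain ⟨K, hK⟩ := hF
  refine unique_volterra (A.lipschitz.add hK) (w := fun t => x + B (η t))
    hy.1 hz.1 (fun t => ?_) fun t => ?_
  · rw [hy.2 t]; abel_nf
  · rw [hz.2 t]; abel_nf

end Solution

/-- Any process that solves the equation almost surely has the law `transition`. -/
theorem map_eq_transition {Ω : Type*} [MeasurableSpace Ω] {P : Measure Ω} {d n : ℕ}
    {W : ℝ≥0 → Ω → Vec n} (hW : IsWiener P W) {A : Vec d →L[ℝ] Vec d} {F : Vec d → Vec d}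
    {B : Vec n →L[ℝ] Vec d} (hF : ∃ K, LipschitzWith K F) {x : Vec d} {X : ℝ≥0 → Ω → Vec d}
    (hX : ∀ᵐ ω ∂P, IsSolution A F B x (fun t => W t ω) (fun t => X t ω)) (T : ℝ≥0) :
    P.map (X T) = transition P W A F B T x := by
  refine Measure.map_congr ?_
  have hc : ∀ᵐ ω ∂P, ∀ i, Continuous fun t => W t ω i := ae_all_iff.2 fun i => (hW.coord i).cont
  filter_upwards [hX, hc] with ω h1 h2
  have h3 : Continuous fun t => W t ω := by
    have := (PiLp.continuous_toLp 2 fun _ : Fin n => ℝ).comp (continuous_pi h2)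
    exact this
  exact congrFun (h1.eq_solution hF h3) T

end LangevinSDE

/-! For a fixed continuous driving path the equation is deterministic, and Gronwall makes its
solution Lipschitz in the starting point and in the path (sup norm). Positivity then needs two
facts: some continuous path started at `0` steers `x` into the ball (`exists_control`), and the
Wiener process stays uniformly close to any such path with positive probability
(`IsWiener.measure_close_pos`).

Steering is done at the last moment. Let `y` be the uncontrolled solution and use the Kalman
condition to write `x₀ - y T = ∑ Aʲ B vⱼ`. With `θ` a smooth step from `0` to `1` on `[T - τ, T]`,
the control `∑ θ⁽ʲ⁾ vⱼ` adds to `y` a correction of size `O(τ⁻ᵐ)` ending exactly at `x₀ - y T`. The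
corrected curve solves the equation up to a defect living on `[T - τ, T]`. The linear part
contributes a bounded defect, and the change in `F` one of size `O(τ^(-m a))`; the integral is `O(τ
+ τ^(1 - m a))`, which vanishes with `τ` because `m a < 1`.

For the Wiener process, deviations from grid interpolation are independent of the grid values. Fine
grids make the former small with positive probability, and independent Gaussian increments give the
latter full support.

Lower semicontinuity holds because, for almost every path, landing in an open set persists under
small changes of `(x, T)`. -/

open MeasureTheory ProbabilityTheory
open scoped NNReal ENNReal

namespace LangevinSDE

/-! ### Gronwall stability of Volterra equations -/

section Stability

variable {E : Type*} [NormedAddCommGroup E] [NormedSpace ℝ E] [CompleteSpace E]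

/-- Continuous solutions of a Volterra equation with Lipschitz `G` depend on the forcing in a
Lipschitz way. -/
theorem norm_sub_le_of_volterra {K : ℝ≥0} {G : E → E} (hG : LipschitzWith K G)
    {y z p q : ℝ≥0 → E} (hy : Continuous y) (hz : Continuous z) {T : ℝ≥0} {c : ℝ}
    (hy' : ∀ t ≤ T, y t = p t + ∫ s in (0 : ℝ)..t, G (y s.toNNReal))
    (hz' : ∀ t ≤ T, z t = q t + ∫ s in (0 : ℝ)..t, G (z s.toNNReal))
    (hpq : ∀ t ≤ T, ‖p t - q t‖ ≤ c) {t : ℝ≥0} (ht : t ≤ T) :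
    ‖y t - z t‖ ≤ c * Real.exp (K * t) := by
  have hGc := hG.continuous
  -- Gronwall is applied to the integral terms only: the forcings `p`, `q` need not be
  -- differentiable, while `D` is, with `‖D'‖ ≤ K ‖D‖ + K c`.
  set D : ℝ → E := fun r => ∫ s in (0 : ℝ)..r, (G (y s.toNNReal) - G (z s.toNNReal)) with hD
  have hc : Continuous fun s : ℝ => G (y s.toNNReal) - G (z s.toNNReal) := by fun_prop
  have hyz : ∀ r : ℝ≥0, r ≤ T → ‖y r - z r‖ ≤ c + ‖D r‖ := fun r hr => by
    have h1 : y r - z r = (p r - q r) + D r := by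
      rw [hy' r hr, hz' r hr, hD]
      simp only
      rw [intervalIntegral.integral_sub (Continuous.intervalIntegrable (by fun_prop) _ _)
        (Continuous.intervalIntegrable (by fun_prop) _ _)]
      abel
    rw [h1]
    exact (norm_add_le _ _).trans (by linarith [hpq r hr])
  have hg := norm_le_gronwallBound_of_norm_deriv_right_le (f := D)
    (f' := fun s => G (y s.toNNReal) - G (z s.toNNReal)) (δ := 0) (K := K) (ε := K * c)
    (a := 0) (b := T)
    (intervalIntegral.continuous_primitive (fun a b => hc.intervalIntegrable a b) 0).continuousOn
    (fun s _ => (intervalIntegral.integral_hasDerivAt_right (hc.intervalIntegrable 0 s)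
      (hc.stronglyMeasurableAtFilter _ _) hc.continuousAt).hasDerivWithinAt)
    (by simp [hD])
    (fun s hs => by
      have h1 := hG.norm_sub_le (y s.toNNReal) (z s.toNNReal)
      have h2 := hyz s.toNNReal (Real.toNNReal_le_iff_le_coe.2 hs.2.le)
      rw [Real.coe_toNNReal s hs.1] at h2
      refine h1.trans ?_
      have := mul_le_mul_of_nonneg_left h2 K.coe_nonneg
      linarith)
    t ⟨t.2, NNReal.coe_le_coe.2 ht⟩
  have h3 : gronwallBound 0 K (K * c) (t - 0) = c * Real.exp (K * t) - c := by
    by_cases hK : (K : ℝ) = 0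
    · rw [hK, gronwallBound_K0]; simp
    · rw [gronwallBound_of_K_ne_0 hK]
      field_simp
      simp
  rw [h3] at hg
  linarith [hyz t ht]

end Stability

/-! ### A smooth step and its derivatives -/

section Step

theorem smoothTransition_hasDerivAt_iteratedDeriv (k : ℕ) (x : ℝ) :
    HasDerivAt (iteratedDeriv k Real.smoothTransition)
      (iteratedDeriv (k + 1) Real.smoothTransition x) x := by
  rw [iteratedDeriv_succ]
  exact ((Real.smoothTransition.contDiff (n := ⊤)).differentiable_iteratedDeriv k
    (by exact_mod_cast ENat.natCast_lt_top k) x).hasDerivAt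

/-- Locally constant on the open half-line; continuity of the derivative carries the vanishing to
the endpoint. -/
theorem smoothTransition_iteratedDeriv_of_nonpos (k : ℕ) {x : ℝ} (hx : x ≤ 0) :
    iteratedDeriv k Real.smoothTransition x = 0 := by
  have hc : Continuous (iteratedDeriv k Real.smoothTransition) :=
    continuous_iff_continuousAt.2 fun x =>
      (smoothTransition_hasDerivAt_iteratedDeriv k x).continuousAt
  have hcl : IsClosed {x | iteratedDeriv k Real.smoothTransition x = 0} :=
    isClosed_eq hc continuous_const
  have hsub : Set.Iio 0 ⊆ {x | iteratedDeriv k Real.smoothTransition x = 0} := fun x hx => by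
    have : Real.smoothTransition =ᶠ[nhds x] fun _ => 0 := by
      filter_upwards [Iio_mem_nhds hx] with y hy
      exact Real.smoothTransition.zero_of_nonpos (le_of_lt hy)
    simp only [Set.mem_ofPred_eq]
    rw [this.iteratedDeriv_eq k]
    simp
  exact hcl.closure_subset_iff.2 hsub (by rwa [closure_Iio])

theorem smoothTransition_iteratedDeriv_of_one_le (k : ℕ) {x : ℝ} (hx : 1 ≤ x) :
    iteratedDeriv (k + 1) Real.smoothTransition x = 0 := by
  have hc : Continuous (iteratedDeriv (k + 1) Real.smoothTransition) :=
    continuous_iff_continuousAt.2 fun x =>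
      (smoothTransition_hasDerivAt_iteratedDeriv (k + 1) x).continuousAt
  have hcl : IsClosed {x | iteratedDeriv (k + 1) Real.smoothTransition x = 0} :=
    isClosed_eq hc continuous_const
  have hsub : Set.Ioi 1 ⊆ {x | iteratedDeriv (k + 1) Real.smoothTransition x = 0} :=
    fun x hx => by
      have : Real.smoothTransition =ᶠ[nhds x] fun _ => 1 := by
        filter_upwards [Ioi_mem_nhds hx] with y hy
        exact Real.smoothTransition.one_of_one_le (le_of_lt hy)
      simp only [Set.mem_ofPred_eq]
      rw [this.iteratedDeriv_eq (k + 1)]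
      simp [iteratedDeriv_const]
  exact hcl.closure_subset_iff.2 hsub (by rwa [closure_Ioi])

theorem smoothTransition_iteratedDeriv_bounded (k : ℕ) :
    ∃ C, 0 ≤ C ∧ ∀ x, |iteratedDeriv k Real.smoothTransition x| ≤ C := by
  have hc : Continuous (iteratedDeriv k Real.smoothTransition) :=
    continuous_iff_continuousAt.2 fun x =>
      (smoothTransition_hasDerivAt_iteratedDeriv k x).continuousAt
  obtain ⟨C, hC⟩ := (isCompact_Icc (a := (0 : ℝ)) (b := 1)).exists_bound_of_continuousOn
    hc.continuousOn
  refine ⟨max C 1, by positivity, fun x => ?_⟩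
  rcases le_total x 0 with h0 | h0
  · rw [smoothTransition_iteratedDeriv_of_nonpos k h0]; simp
  rcases le_total x 1 with h1 | h1
  · exact (hC x ⟨h0, h1⟩).trans (le_max_left _ _)
  cases k with
  | zero => simp [Real.smoothTransition.one_of_one_le h1]
  | succ k => rw [smoothTransition_iteratedDeriv_of_one_le k h1]; simp

/-- The `k`-th derivative of a smooth function that rises from `0` to `1` on `[T - τ, T]`. -/
noncomputable def stepDeriv (T τ : ℝ) (k : ℕ) (t : ℝ) : ℝ :=
  τ⁻¹ ^ k * iteratedDeriv k Real.smoothTransition ((t - (T - τ)) / τ)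

variable {T τ : ℝ}

theorem hasDerivAt_stepDeriv (k : ℕ) (t : ℝ) :
    HasDerivAt (stepDeriv T τ k) (stepDeriv T τ (k + 1) t) t := by
  have h1 : HasDerivAt (fun t => (t - (T - τ)) / τ) (1 / τ) t :=
    ((hasDerivAt_id t).sub_const _).div_const _
  have h2 := ((smoothTransition_hasDerivAt_iteratedDeriv k _).comp t h1).const_mul (τ⁻¹ ^ k)
  convert! h2 using 1
  simp only [stepDeriv]
  ring

theorem stepDeriv_of_le (hτ : 0 < τ) (k : ℕ) {t : ℝ} (ht : t ≤ T - τ) : stepDeriv T τ k t = 0 := by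
  rw [stepDeriv, smoothTransition_iteratedDeriv_of_nonpos, mul_zero]
  exact div_nonpos_of_nonpos_of_nonneg (by linarith) hτ.le

theorem stepDeriv_zero_self (hτ : 0 < τ) : stepDeriv T τ 0 T = 1 := by
  simp [stepDeriv, hτ.ne', Real.smoothTransition.one]

theorem stepDeriv_succ_self (hτ : 0 < τ) (k : ℕ) : stepDeriv T τ (k + 1) T = 0 := by
  rw [stepDeriv, smoothTransition_iteratedDeriv_of_one_le, mul_zero]
  simp [hτ.ne']

theorem stepDeriv_bounded (k : ℕ) :
    ∃ C, 0 ≤ C ∧ ∀ T τ t : ℝ, 0 < τ → |stepDeriv T τ k t| ≤ C * τ⁻¹ ^ k := by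
  obtain ⟨C, hC, h⟩ := smoothTransition_iteratedDeriv_bounded k
  refine ⟨C, hC, fun T τ t hτ => ?_⟩
  rw [stepDeriv, abs_mul, abs_of_pos (by positivity), mul_comm]
  exact mul_le_mul_of_nonneg_right (h _) (by positivity)

end Step

/-! ### Exact trajectories for a single Kalman direction -/

section Chain

variable {E : Type*} [NormedAddCommGroup E] [NormedSpace ℝ E]

/-- The trajectory of `z' = A z + u θ⁽ʲ⁺¹⁾ - θ Aʲ⁺¹ u`, where `θ` is the smooth step. -/
noncomputable def chain (T τ : ℝ) (A : E →L[ℝ] E) (u : E) : ℕ → ℝ → E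
  | 0, t => stepDeriv T τ 0 t • u
  | j + 1, t => A (chain T τ A u j t) + stepDeriv T τ (j + 1) t • u

variable {T τ : ℝ} {A : E →L[ℝ] E} {u : E}

/-- Unrolled, the trajectory is `∑ i ≤ j, θ⁽ⁱ⁾ Aʲ⁻ⁱ u`. Differentiating shifts the sum by one, which
is multiplication by `A` up to the two end terms. -/
theorem hasDerivAt_chain (j : ℕ) (t : ℝ) :
    HasDerivAt (chain T τ A u j) (A (chain T τ A u j t) - stepDeriv T τ 0 t • (A ^ (j + 1)) u
      + stepDeriv T τ (j + 1) t • u) t := by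
  induction j with
  | zero =>
    have := (hasDerivAt_stepDeriv (T := T) (τ := τ) 0 t).smul_const u
    convert! this using 1
    simp [chain]
  | succ j ih =>
    have h1 := A.hasFDerivAt.comp_hasDerivAt t ih
    have := h1.add ((hasDerivAt_stepDeriv (T := T) (τ := τ) (j + 1) t).smul_const u)
    convert! this using 1
    simp only [chain, map_add, map_sub, map_smul, pow_succ' A (j + 1),
      mul_apply_eq_comp]
    abel

theorem chain_of_le (hτ : 0 < τ) (j : ℕ) {t : ℝ} (ht : t ≤ T - τ) : chain T τ A u j t = 0 := by
  induction j with
  | zero => simp [chain, stepDeriv_of_le hτ 0 ht]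
  | succ j ih => simp [chain, stepDeriv_of_le hτ _ ht, ih]

theorem chain_self (hτ : 0 < τ) (j : ℕ) : chain T τ A u j T = (A ^ j) u := by
  induction j with
  | zero => simp [chain, stepDeriv_zero_self hτ]
  | succ j ih => simp [chain, stepDeriv_succ_self hτ, ih, pow_succ' A j]

/-- Each derivative of the step costs a factor `τ⁻¹`, and `τ ≤ 1` lets the highest order dominate.
The constant is uniform in `T`, `τ` and `t`. -/
theorem chain_bounded (A : E →L[ℝ] E) (u : E) (j : ℕ) :
    ∃ C, 0 ≤ C ∧ ∀ T τ t : ℝ, 0 < τ → τ ≤ 1 → ‖chain T τ A u j t‖ ≤ C * τ⁻¹ ^ j := by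
  induction j with
  | zero =>
    obtain ⟨C, hC, h⟩ := stepDeriv_bounded 0
    refine ⟨C * ‖u‖, by positivity, fun T τ t hτ _ => ?_⟩
    rw [chain, norm_smul, Real.norm_eq_abs]
    have := mul_le_mul_of_nonneg_right (h T τ t hτ) (norm_nonneg u)
    simpa using this
  | succ j ih =>
    obtain ⟨C, hC, h⟩ := stepDeriv_bounded (j + 1)
    obtain ⟨C', hC', h'⟩ := ih
    refine ⟨‖A‖ * C' + C * ‖u‖, by positivity, fun T τ t hτ hτ1 => ?_⟩
    have h1 : ‖A (chain T τ A u j t)‖ ≤ ‖A‖ * (C' * τ⁻¹ ^ j) :=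
      (A.le_opNorm _).trans (mul_le_mul_of_nonneg_left (h' T τ t hτ hτ1) (norm_nonneg _))
    have h2 : τ⁻¹ ^ j ≤ τ⁻¹ ^ (j + 1) :=
      pow_le_pow_right₀ (one_le_inv_iff₀.2 ⟨hτ, hτ1⟩) (Nat.le_succ j)
    have h3 : ‖stepDeriv T τ (j + 1) t • u‖ ≤ C * τ⁻¹ ^ (j + 1) * ‖u‖ := by
      rw [norm_smul, Real.norm_eq_abs]
      exact mul_le_mul_of_nonneg_right (h T τ t hτ) (norm_nonneg u)
    calc ‖chain T τ A u (j + 1) t‖ ≤ ‖A‖ * (C' * τ⁻¹ ^ j) + C * τ⁻¹ ^ (j + 1) * ‖u‖ :=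
          (norm_add_le _ _).trans (add_le_add h1 h3)
      _ ≤ ‖A‖ * (C' * τ⁻¹ ^ (j + 1)) + C * τ⁻¹ ^ (j + 1) * ‖u‖ := by gcongr
      _ = _ := by ring

end Chain

/-- Every vector is a combination `∑ Aʲ B vⱼ` when the Kalman span is everything. -/
theorem exists_eq_sum_of_kalmanSpan_eq_top {d n : ℕ} {A : Vec d →L[ℝ] Vec d}
    {B : Vec n →L[ℝ] Vec d} {m : ℕ} (h : kalmanSpan A B m = ⊤) (e : Vec d) :
    ∃ v : ℕ → Vec n, ∑ j ∈ Finset.range m, (A ^ j) (B (v j)) = e := by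
  have he : e ∈ kalmanSpan A B m := h ▸ Submodule.mem_top
  rw [kalmanSpan] at he
  induction he using Submodule.span_induction with
  | mem x hx =>
    obtain ⟨k, hk, i, rfl⟩ := hx
    refine ⟨Pi.single k (EuclideanSpace.single i 1), ?_⟩
    rw [Finset.sum_eq_single k]
    · simp
    · intro j _ hj
      simp [Pi.single_eq_of_ne hj]
    · intro hk'
      exact absurd (Finset.mem_range.2 hk) hk'
  | zero => exact ⟨0, by simp⟩
  | add x y _ _ hx hy =>
    obtain ⟨v, rfl⟩ := hx
    obtain ⟨w, rfl⟩ := hy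
    exact ⟨v + w, by simp [Finset.sum_add_distrib]⟩
  | smul c x _ hx =>
    obtain ⟨v, rfl⟩ := hx
    exact ⟨c • v, by simp [Finset.smul_sum]⟩

/-! ### Steering the deterministic system -/

section Control

variable {d n : ℕ} {A : Vec d →L[ℝ] Vec d} {F : Vec d → Vec d} {B : Vec n →L[ℝ] Vec d}

/-- An approximate solution with small accumulated defect `g` is close to the solution. -/
theorem norm_solution_sub_le {K : ℝ≥0} (hF : LipschitzWith K F) {x : Vec d} {η : ℝ≥0 → Vec n}
    (hη : Continuous η) {z : ℝ≥0 → Vec d} (hz : Continuous z) {g : ℝ≥0 → Vec d} {T : ℝ≥0} {c : ℝ}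
    (hz' : ∀ t ≤ T, z t = x + (∫ s in (0 : ℝ)..t, (A (z s.toNNReal) + F (z s.toNNReal)))
      + B (η t) + g t)
    (hg : ∀ t ≤ T, ‖g t‖ ≤ c) {t : ℝ≥0} (ht : t ≤ T) :
    ‖solution A F B x η t - z t‖ ≤ c * Real.exp ((‖A‖₊ + K : ℝ≥0) * t) := by
  have hs := isSolution_solution (A := A) (B := B) (x := x) ⟨K, hF⟩ hη
  refine norm_sub_le_of_volterra (A.lipschitz.add hF) (p := fun t => x + B (η t))
    (q := fun t => x + B (η t) + g t) hs.1 hz (fun t _ => ?_) (fun t ht => ?_) (fun t ht => ?_) ht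
  · rw [hs.2 t]; abel_nf
  · rw [hz' t ht]; abel_nf
  · simpa using hg t ht

theorem GrowthCondition.exists_norm_le {F : Vec d → Vec d} {m : ℕ} (h : GrowthCondition F m) :
    ∃ a C : ℝ, 0 ≤ a ∧ m * a < 1 ∧ 0 ≤ C ∧ ∀ x, ‖F x‖ ≤ C * (1 + ‖x‖) ^ a := by
  obtain ⟨a, ha, ham, C, hC⟩ := h
  refine ⟨a, max C 0, ha, ?_, le_max_right _ _, fun x => ?_⟩
  -- For `m = 0` the bound `1 / (2 m)` is `0` by convention and cannot be cleared, but `m * a = 0 <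
  -- 1` anyway.
  · rcases Nat.eq_zero_or_pos m with rfl | hm
    · simp
    · have hm' : (0 : ℝ) < m := by exact_mod_cast hm
      rw [lt_div_iff₀ (by positivity)] at ham
      nlinarith
  · have h1 : 0 < (1 + ‖x‖) ^ a := by positivity
    have h2 := hC ⟨x, rfl⟩
    simp only at h2
    rw [div_le_iff₀ h1] at h2
    exact h2.trans (mul_le_mul_of_nonneg_right (le_max_left _ _) h1.le)

/-- The system can be steered from `x` arbitrarily close to `x₀` in any positive time. -/
theorem exists_control (hF : ∃ K, LipschitzWith K F) {m : ℕ} (hm : kalmanSpan A B m = ⊤)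
    (hG : GrowthCondition F m) (x x₀ : Vec d) {T : ℝ≥0} (hT : 0 < T) {δ : ℝ} (hδ : 0 < δ) :
    ∃ η : ℝ≥0 → Vec n, Continuous η ∧ η 0 = 0 ∧ solution A F B x η T ∈ Metric.ball x₀ δ := by
  obtain ⟨K, hK⟩ := hF
  have hFc := hK.continuous
  obtain ⟨a, CF, ha, ham, hCF, hFb⟩ := hG.exists_norm_le
  set y := solution A F B x (fun _ : ℝ≥0 => (0 : Vec n)) with hy
  have hys : IsSolution A F B x (fun _ => 0) y := isSolution_solution ⟨K, hK⟩ continuous_const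
  have hyc : Continuous y := hys.1
  obtain ⟨v, hv⟩ := exists_eq_sum_of_kalmanSpan_eq_top hm (x₀ - y T)
  set w : Vec d := ∑ j ∈ Finset.range m, (A ^ (j + 1)) (B (v j)) with hw
  set S : ℝ → ℝ → Vec d := fun τ t => ∑ j ∈ Finset.range m, chain T τ A (B (v j)) j t with hS
  set η : ℝ → ℝ → Vec n := fun τ t => ∑ j ∈ Finset.range m, stepDeriv T τ j t • v j with hη
  have hθc : ∀ τ k, Continuous (stepDeriv T τ k) := fun τ k =>
    continuous_iff_continuousAt.2 fun t => (hasDerivAt_stepDeriv k t).continuousAt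
  have hηc : ∀ τ, Continuous (η τ) := fun τ =>
    continuous_finsetSum _ fun j _ => (hθc τ j).smul continuous_const
  have hSc : ∀ τ, Continuous (S τ) := fun τ =>
    continuous_finsetSum _ fun j _ => continuous_iff_continuousAt.2 fun t =>
      (hasDerivAt_chain j t).continuousAt
  -- Subtracting `B η` cancels the top derivatives `θ⁽ʲ⁺¹⁾ B vⱼ`; only the bounded term `θ w`
  -- remains beside `A S`.
  have hSd : ∀ τ t, HasDerivAt (fun t => S τ t - B (η τ t))
      (A (S τ t) - stepDeriv T τ 0 t • w) t := fun τ t => by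
    have h1 : HasDerivAt (S τ) (∑ j ∈ Finset.range m, (A (chain T τ A (B (v j)) j t)
        - stepDeriv T τ 0 t • (A ^ (j + 1)) (B (v j)) + stepDeriv T τ (j + 1) t • B (v j))) t :=
      HasDerivAt.fun_sum fun j _ => hasDerivAt_chain j t
    have h2 : HasDerivAt (η τ) (∑ j ∈ Finset.range m, stepDeriv T τ (j + 1) t • v j) t :=
      HasDerivAt.fun_sum fun j _ => (hasDerivAt_stepDeriv j t).smul_const _
    have h3 := h1.sub (B.hasFDerivAt.comp_hasDerivAt t h2)
    convert! h3 using 1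
    simp only [hS, hw, map_sum, map_smul, Finset.sum_add_distrib, Finset.sum_sub_distrib,
      Finset.smul_sum]
    abel
  have hSb : ∃ C, 0 ≤ C ∧ ∀ τ t : ℝ, 0 < τ → τ ≤ 1 → ‖S τ t‖ ≤ C * τ⁻¹ ^ m := by
    choose C hC0 hC using fun j => chain_bounded A (B (v j)) j
    refine ⟨∑ j ∈ Finset.range m, C j, Finset.sum_nonneg fun j _ => hC0 j,
      fun τ t hτ hτ1 => ?_⟩
    rw [Finset.sum_mul]
    refine norm_sum_le_of_le _ fun j hj => (hC j T τ t hτ hτ1).trans ?_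
    exact mul_le_mul_of_nonneg_left (pow_le_pow_right₀ (one_le_inv_iff₀.2 ⟨hτ, hτ1⟩)
      (Finset.mem_range.1 hj).le) (hC0 j)
  obtain ⟨C, hC0, hC⟩ := hSb
  obtain ⟨Cθ, hCθ0, hCθ⟩ := stepDeriv_bounded 0
  obtain ⟨Y, hY⟩ := (isCompact_Icc (a := (0 : ℝ≥0)) (b := T)).exists_bound_of_continuousOn
    hyc.continuousOn
  have hY0 : 0 ≤ Y := (norm_nonneg _).trans (hY 0 ⟨le_rfl, hT.le⟩)
  set L : ℝ := Real.exp ((‖A‖₊ + K : ℝ≥0) * T) with hL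
  set c₁ : ℝ := CF * (1 + Y) ^ a + Cθ * ‖w‖ with hc₁
  set c₂ : ℝ := CF * (1 + Y + C) ^ a with hc₂
  have hlim : Filter.Tendsto (fun τ : ℝ => (c₁ * τ + c₂ * τ ^ (1 - m * a)) * L)
      (nhdsWithin 0 (Set.Ioi 0)) (nhds 0) := by
    have h1 : Filter.Tendsto (fun τ : ℝ => τ ^ (1 - m * a)) (nhds 0) (nhds 0) := by
      have := (Real.continuousAt_rpow_const 0 (1 - m * a) (Or.inr (by linarith))).tendsto
      rwa [Real.zero_rpow (by linarith)] at this
    have h2 : Filter.Tendsto (fun τ : ℝ => (c₁ * τ + c₂ * τ ^ (1 - m * a)) * L)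
        (nhds 0) (nhds ((c₁ * 0 + c₂ * 0) * L)) :=
      ((Filter.tendsto_id.const_mul c₁).add (h1.const_mul c₂)).mul_const L
    simp only [mul_zero, add_zero, zero_mul] at h2
    exact h2.mono_left nhdsWithin_le_nhds
  have hev : ∀ᶠ τ : ℝ in nhdsWithin 0 (Set.Ioi 0), 0 < τ ∧ τ < 1 ∧ τ < T ∧
      (c₁ * τ + c₂ * τ ^ (1 - m * a)) * L < δ := by
    have hT' : (0 : ℝ) < T := hT
    filter_upwards [self_mem_nhdsWithin, nhdsWithin_le_nhds (Iio_mem_nhds one_pos),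
      nhdsWithin_le_nhds (Iio_mem_nhds hT'), hlim.eventually (Iio_mem_nhds hδ)] with τ h1 h2 h3 h4
    exact ⟨h1, h2, h3, h4⟩
  obtain ⟨τ, hτ, hτ1, hτT, hτδ⟩ := hev.exists
  have hle0 : (0 : ℝ) ≤ T - τ := by linarith
  have hη0 : η τ 0 = 0 := by
    simp only [hη]
    exact Finset.sum_eq_zero fun j _ => by rw [stepDeriv_of_le hτ j hle0, zero_smul]
  have hS0 : ∀ t ≤ (T : ℝ) - τ, S τ t = 0 := fun t ht =>
    Finset.sum_eq_zero fun j _ => chain_of_le hτ j ht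
  refine ⟨fun t => η τ t, (hηc τ).comp NNReal.continuous_coe, hη0, ?_⟩
  set z : ℝ≥0 → Vec d := fun t => y t + S τ t with hz
  have hzc : Continuous z := hyc.add ((hSc τ).comp NNReal.continuous_coe)
  have hzT : z T = x₀ := by
    simp only [hz, hS, chain_self hτ]
    rw [hv]; abel
  -- The defect rate of `z`: what must be added to `A z + F z` to recover the actual drift of `z`.
  set g : ℝ → Vec d := fun s => F (y s.toNNReal) - F (z s.toNNReal) - stepDeriv T τ 0 s • w
    with hg
  have hgc : Continuous g := by
    have := hθc τ 0
    simp only [hg]; fun_prop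
  set H : ℝ := c₁ + c₂ * (τ⁻¹ ^ m) ^ a with hH
  have hg0 : ∀ s, 0 ≤ s → s ≤ (T : ℝ) - τ → g s = 0 := fun s hs0 hs => by
    simp only [hg, hz, Real.coe_toNNReal s hs0, hS0 s hs, stepDeriv_of_le hτ 0 hs]
    simp
  have hgb : ∀ s, 0 ≤ s → s ≤ (T : ℝ) → ‖g s‖ ≤ H := fun s hs0 hs => by
    have hyb := hY s.toNNReal ⟨by simp, Real.toNNReal_le_iff_le_coe.2 hs⟩
    have hp : (1 : ℝ) ≤ τ⁻¹ ^ m := one_le_pow₀ (one_le_inv_iff₀.2 ⟨hτ, hτ1.le⟩)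
    have h1 : ‖F (y s.toNNReal)‖ ≤ CF * (1 + Y) ^ a :=
      (hFb _).trans (by gcongr)
    have h2 : ‖z s.toNNReal‖ ≤ Y + C * τ⁻¹ ^ m :=
      (norm_add_le _ _).trans (add_le_add hyb (hC τ _ hτ hτ1.le))
    have h3 : ‖F (z s.toNNReal)‖ ≤ c₂ * (τ⁻¹ ^ m) ^ a := by
      refine (hFb _).trans ?_
      -- As `τ⁻ᵐ ≥ 1`, the sum `1 + Y + C τ⁻ᵐ` is at most `(1 + Y + C) τ⁻ᵐ`.
      rw [hc₂, mul_assoc, ← Real.mul_rpow (by positivity) (by positivity)]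
      gcongr
      nlinarith
    have h4 : ‖stepDeriv T τ 0 s • w‖ ≤ Cθ * ‖w‖ := by
      rw [norm_smul, Real.norm_eq_abs]
      have := hCθ T τ s hτ
      rw [pow_zero, mul_one] at this
      gcongr
    have h5 := norm_sub_le (F (y s.toNNReal) - F (z s.toNNReal)) (stepDeriv T τ 0 s • w)
    have h6 := norm_sub_le (F (y s.toNNReal)) (F (z s.toNNReal))
    simp only [hg, hH, hc₁]
    linarith
  have hH0 : 0 ≤ H := by positivity
  have hgi : ∀ t : ℝ≥0, t ≤ T → ‖∫ s in (0 : ℝ)..t, g s‖ ≤ H * τ := fun t ht => by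
    have htT : (t : ℝ) ≤ T := ht
    set r : ℝ := min t (T - τ) with hr
    have hr0 : 0 ≤ r := le_min t.2 hle0
    have hrt : r ≤ t := min_le_left _ _
    rw [← intervalIntegral.integral_add_adjacent_intervals
      (hgc.intervalIntegrable 0 r) (hgc.intervalIntegrable r t)]
    have h1 : ∫ s in (0 : ℝ)..r, g s = 0 := by
      rw [intervalIntegral.integral_congr (g := fun _ => 0)]
      · simp
      · intro s hs
        rw [Set.uIcc_of_le hr0] at hs
        exact hg0 s hs.1 (hs.2.trans (min_le_right _ _))
    rw [h1, zero_add]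
    refine (intervalIntegral.norm_integral_le_of_norm_le_const (C := H) fun s hs => ?_).trans ?_
    · rw [Set.uIoc_of_le hrt] at hs
      exact hgb s (hr0.trans hs.1.le) (hs.2.trans htT)
    · refine mul_le_mul_of_nonneg_left ?_ hH0
      rw [abs_of_nonneg (by linarith)]
      rcases min_choice (t : ℝ) (T - τ) with h | h <;> rw [hr, h] <;> linarith
  have key := norm_solution_sub_le (A := A) (B := B) (x := x) hK
    (η := fun t => η τ t) ((hηc τ).comp NNReal.continuous_coe) hzc
    (g := fun t => ∫ s in (0 : ℝ)..t, g s) (T := T) (c := H * τ) (fun t ht => ?_) hgi le_rfl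
  · rw [mem_ball_iff_norm]
    rw [hzT] at key
    refine key.trans_lt (lt_of_eq_of_lt ?_ hτδ)
    have h1 : (τ⁻¹ ^ m) ^ a * τ = τ ^ (1 - m * a) := by
      rw [← Real.rpow_natCast, Real.inv_rpow hτ.le, ← Real.rpow_neg hτ.le, ← Real.rpow_mul hτ.le,
        sub_eq_add_neg, Real.rpow_add hτ, Real.rpow_one, mul_comm]
      congr 2
      ring
    rw [← h1, hH]
    ring
  · have h1 := intervalIntegral.integral_eq_sub_of_hasDerivAt (a := 0) (b := t)
      (fun s _ => hSd τ s) (Continuous.intervalIntegrable (by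
        have := hSc τ
        have := hθc τ 0
        fun_prop) _ _)
    rw [hS0 0 hle0, hη0, map_zero, sub_zero, sub_zero] at h1
    have hSt : S τ t = (∫ s in (0 : ℝ)..t, (A (S τ s) - stepDeriv T τ 0 s • w)) + B (η τ t) := by
      rw [h1]; abel
    have hSc' := hSc τ
    have hθc' := hθc τ 0
    have hsplit : (∫ s in (0 : ℝ)..t, (A (z s.toNNReal) + F (z s.toNNReal)))
        + ∫ s in (0 : ℝ)..t, g s = (∫ s in (0 : ℝ)..t, (A (y s.toNNReal) + F (y s.toNNReal)))
        + ∫ s in (0 : ℝ)..t, (A (S τ s) - stepDeriv T τ 0 s • w) := by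
      rw [← intervalIntegral.integral_add, ← intervalIntegral.integral_add]
      · refine intervalIntegral.integral_congr fun s hs => ?_
        rw [Set.uIcc_of_le (show (0 : ℝ) ≤ t from t.2)] at hs
        simp only [hg, hz, Real.coe_toNNReal s hs.1, map_add]
        abel
      all_goals exact Continuous.intervalIntegrable (by fun_prop) _ _
    have hyt := hys.2 t
    rw [map_zero, add_zero] at hyt
    calc z t = x + ((∫ s in (0 : ℝ)..t, (A (y s.toNNReal) + F (y s.toNNReal)))
        + ∫ s in (0 : ℝ)..t, (A (S τ s) - stepDeriv T τ 0 s • w)) + B (η τ t) := by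
          simp only [hz]
          rw [hyt, hSt]; abel
      _ = _ := by rw [← hsplit]; abel

end Control

/-! ### Linear interpolation on a grid -/

section Interpolation

/-- Piecewise linear interpolation of `f` on the grid `{0, h, 2 h, …}`. -/
noncomputable def gridInterp (h : ℝ≥0) (f : ℝ≥0 → ℝ) (t : ℝ≥0) : ℝ :=
  (1 - (t / h - ⌊t / h⌋₊ : ℝ)) * f (⌊t / h⌋₊ * h) + (t / h - ⌊t / h⌋₊ : ℝ) * f ((⌊t / h⌋₊ + 1) * h)

variable {h : ℝ≥0} {f : ℝ≥0 → ℝ} {t : ℝ≥0} {c : ℝ}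

theorem gridInterp_sub (g : ℝ≥0 → ℝ) :
    gridInterp h (fun s => f s - g s) t = gridInterp h f t - gridInterp h g t := by
  simp only [gridInterp]; ring

theorem floor_mul_le (hh : 0 < h) (t : ℝ≥0) : ⌊t / h⌋₊ * h ≤ t := by
  have := Nat.floor_le (zero_le (a := t / h))
  rwa [le_div_iff₀ hh] at this

theorem lt_floor_add_one_mul (hh : 0 < h) (t : ℝ≥0) : t < (⌊t / h⌋₊ + 1) * h := by
  have := Nat.lt_floor_add_one (t / h)
  rwa [div_lt_iff₀ hh] at this

theorem abs_gridInterp_le (hh : 0 < h)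
    (h1 : |f (⌊t / h⌋₊ * h)| ≤ c) (h2 : |f ((⌊t / h⌋₊ + 1) * h)| ≤ c) :
    |gridInterp h f t| ≤ c := by
  have hh' : (0 : ℝ) < h := hh
  have h3 : (⌊t / h⌋₊ * h : ℝ) ≤ t := by exact_mod_cast floor_mul_le hh t
  have h4 : (t : ℝ) ≤ (⌊t / h⌋₊ + 1) * h := by exact_mod_cast (lt_floor_add_one_mul hh t).le
  rw [← le_div_iff₀ hh'] at h3
  rw [← div_le_iff₀ hh'] at h4
  rw [abs_le] at *
  simp only [gridInterp]
  constructor <;> nlinarith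

/-- Interpolation reproduces constants, so the error is the interpolation of `s ↦ f t - f s`, and
both grid neighbours of `t` lie within `h`. -/
theorem abs_sub_gridInterp_le (hh : 0 < h)
    (H : ∀ s, dist s t ≤ h → |f t - f s| ≤ c) : |f t - gridInterp h f t| ≤ c := by
  have h3 : (⌊t / h⌋₊ * h : ℝ) ≤ t := by exact_mod_cast floor_mul_le hh t
  have h4 : (t : ℝ) ≤ (⌊t / h⌋₊ + 1) * h := by exact_mod_cast (lt_floor_add_one_mul hh t).le
  have h0 : f t - gridInterp h f t = gridInterp h (fun s => f t - f s) t := by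
    simp only [gridInterp]; ring
  rw [h0]
  refine abs_gridInterp_le hh (H _ ?_) (H _ ?_)
  all_goals
    rw [NNReal.dist_eq, abs_le]
    push_cast
    constructor <;> linarith

/-- On a bounded interval, interpolation of a continuous function on a fine grid is accurate. -/
theorem eventually_abs_sub_gridInterp_le (hf : Continuous f) (S : ℝ≥0) (hc : 0 < c) :
    ∃ ρ : ℝ, 0 < ρ ∧ ∀ h : ℝ≥0, 0 < h → (h : ℝ) ≤ ρ → ∀ t ≤ S, |f t - gridInterp h f t| ≤ c := by
  -- The right-hand grid node of a cell may exceed `S`, by at most `h ≤ 1`.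
  have hu := (isCompact_Icc (a := (0 : ℝ≥0)) (b := S + 1)).uniformContinuousOn_of_continuous
    hf.continuousOn
  rw [Metric.uniformContinuousOn_iff] at hu
  obtain ⟨ρ, hρ, H⟩ := hu c hc
  refine ⟨min (ρ / 2) 1, by positivity, fun h hh hhρ t ht =>
    abs_sub_gridInterp_le hh fun s hs => ?_⟩
  have h1 := hhρ.trans (min_le_left _ _)
  have h2 := hhρ.trans (min_le_right _ _)
  have ht' : (t : ℝ) ≤ S := ht
  have hs' : s ≤ S + 1 := by
    rw [NNReal.dist_eq, abs_le] at hs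
    rw [← NNReal.coe_le_coe]
    push_cast
    linarith [hs.2]
  have := H t ⟨zero_le, ht.trans (by simp)⟩ s ⟨zero_le, hs'⟩
    (by rw [dist_comm]; linarith)
  rw [Real.dist_eq] at this
  exact this.le

end Interpolation

/-! ### Support of real Brownian motion -/

section Brownian

variable {Ω : Type*} [MeasurableSpace Ω] {P : Measure Ω} {X : ℝ≥0 → Ω → ℝ}

/-- The deviation of a Brownian motion from its interpolation on a grid is independent of the
values on the grid. -/
theorem indepFun_sub_gridInterp (hX : IsPreBrownianReal X P) {h : ℝ≥0} (hh : 0 < h) :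
    IndepFun (fun ω t => X t ω - gridInterp h (X · ω) t) (fun ω (k : ℕ) => X (k * h) ω) P := by
  have := hX.isGaussianProcess.isProbabilityMeasure
  have mX t := hX.aemeasurable t
  have m2 : ∀ t, MemLp (X t) 2 P := fun t => (hX.isGaussianProcess.hasGaussianLaw_eval t).memLp_two
  apply IsGaussianProcess.indepFun_of_covariance_eq_zero
  · apply hX.isGaussianProcess.of_isGaussianProcess
    rintro (t | k)
    · exact ⟨{t, ⌊t / h⌋₊ * h, (⌊t / h⌋₊ + 1) * h},
        { toFun x := x ⟨t, by simp⟩ - ((1 - (t / h - ⌊t / h⌋₊ : ℝ)) * x ⟨⌊t / h⌋₊ * h, by simp⟩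
            + (t / h - ⌊t / h⌋₊ : ℝ) * x ⟨(⌊t / h⌋₊ + 1) * h, by simp⟩)
          map_add' x y := by simp; ring
          map_smul' c x := by simp; ring }, by simp [gridInterp]⟩
    · exact ⟨{k * h},
        { toFun x := x ⟨k * h, by simp⟩
          map_add' x y := by simp
          map_smul' c x := by simp }, by simp⟩
  · intro t
    simp only [gridInterp]
    fun_prop
  · intro k
    fun_prop
  -- The covariance `min s (k h)` is affine in `s` on each grid cell, its kink being a node; so it
  -- equals its interpolation and the deviation is uncorrelated with `X (k h)`.
  · intro t k
    simp only [gridInterp]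
    have hadd : ∀ (c c' : ℝ) (s s' u : ℝ≥0), cov[fun ω => c * X s ω + c' * X s' ω, X u; P]
        = c * cov[X s, X u; P] + c' * cov[X s', X u; P] := fun c c' s s' u =>
      (covariance_add_left ((m2 s).const_mul c) ((m2 s').const_mul c') (m2 u)).trans
        (by rw [covariance_const_mul_left, covariance_const_mul_left])
    rw [covariance_fun_sub_left (m2 _) ?_ (m2 _), hadd]
    swap
    · exact ((m2 _).const_mul _).add ((m2 _).const_mul _)
    simp only [hX.covariance_eval]
    have h3 := floor_mul_le hh t
    have h4 := (lt_floor_add_one_mul hh t).le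
    have hh' : (h : ℝ) ≠ 0 := by exact_mod_cast hh.ne'
    rcases le_or_gt k ⌊t / h⌋₊ with hk | hk
    · have h5 : (k : ℝ≥0) * h ≤ ⌊t / h⌋₊ * h := by gcongr
      rw [min_eq_right (h5.trans h3), min_eq_right h5, min_eq_right (h5.trans (h3.trans h4))]
      ring
    · have h5 : ((⌊t / h⌋₊ + 1 : ℝ≥0)) * h ≤ k * h := by
        gcongr
        exact_mod_cast hk
      rw [min_eq_left (h4.trans h5), min_eq_left (h3.trans (h4.trans h5)), min_eq_left h5]
      push_cast
      field_simp
      ring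

/-- The values of a Brownian motion on a finite grid are close to prescribed values with positive
probability. -/
theorem measure_grid_pos (hX : IsPreBrownianReal X P) {h : ℝ≥0} (hh : 0 < h) (N : ℕ) {φ : ℝ≥0 → ℝ}
    (hφ : φ 0 = 0) {ε : ℝ} (hε : 0 < ε) :
    0 < P {ω | ∀ k ≤ N, |X (k * h) ω - φ (k * h)| ≤ ε} := by
  have := hX.isGaussianProcess.isProbabilityMeasure
  set t : ℕ → ℝ≥0 := fun k => k * h with ht
  have hmono : Monotone t := fun i j hij => by simp only [ht]; gcongr
  have hind := hX.hasIndepIncrements.nat hmono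
  -- At most `N` increment errors accumulate; the `+ 1` covers `N = 0`.
  set e : ℝ := ε / (N + 1) with he
  have he0 : 0 < e := by positivity
  set s : ℕ → Set ℝ := fun k => Metric.ball (φ (t (k + 1)) - φ (t k)) e with hs
  have hprod := hind.measure_inter_preimage_eq_mul (Finset.range N) (sets := s)
    (fun i _ => measurableSet_ball)
  have hpos : 0 < P (⋂ k ∈ Finset.range N, (fun ω => X (t (k + 1)) ω - X (t k) ω) ⁻¹' s k) := by
    rw [hprod, pos_iff_ne_zero, Finset.prod_ne_zero_iff]
    intro k _
    have hl := hX.hasLaw_sub (t (k + 1)) (t k)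
    have h1 : P ((fun ω => X (t (k + 1)) ω - X (t k) ω) ⁻¹' s k)
        = gaussianReal 0 (nndist (t (k + 1)).1 (t k).1) (s k) := by
      rw [← hl.map_eq, Measure.map_apply_of_aemeasurable hl.aemeasurable measurableSet_ball]
      rfl
    rw [h1]
    have hne : nndist (t (k + 1)).1 (t k).1 ≠ 0 := by
      rw [Ne, nndist_eq_zero]
      intro h2
      have h3 : t (k + 1) = t k := Subtype.ext h2
      simp only [ht] at h3
      have := mul_right_cancel₀ hh.ne' h3
      have h4 : k + 1 = k := by exact_mod_cast this
      omega
    intro h2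
    have := gaussianReal_absolutelyContinuous' 0 hne h2
    exact (Metric.measure_ball_pos volume _ he0).ne' this
  refine hpos.trans_le (measure_mono_ae ?_)
  filter_upwards [hX.eval_zero_ae_eq_zero] with ω h0 hω
  have hω' : ∀ k < N, |(X (t (k + 1)) ω - X (t k) ω) - (φ (t (k + 1)) - φ (t k))| < e := by
    intro k hk
    rw [← Real.dist_eq]
    exact Set.mem_iInter₂.1 hω k (Finset.mem_range.2 hk)
  have hsum : ∀ k ≤ N, |X (t k) ω - φ (t k)| ≤ k * e := by
    intro k
    induction k with
    | zero => intro _; simp [ht, h0, hφ]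
    | succ k ih =>
      intro hk
      have h1 := ih (by omega)
      have h2 := hω' k (by omega)
      have h3 : X (t (k + 1)) ω - φ (t (k + 1)) = (X (t k) ω - φ (t k)) +
        ((X (t (k + 1)) ω - X (t k) ω) - (φ (t (k + 1)) - φ (t k))) := by ring
      rw [h3]
      refine (abs_add_le _ _).trans ?_
      push_cast
      linarith
  intro k hk
  refine (hsum k hk).trans ?_
  have hk' : (k : ℝ) ≤ N := by exact_mod_cast hk
  calc (k : ℝ) * e ≤ (N + 1) * e := by gcongr; linarith
    _ = ε := by rw [he]; field_simp

/-- The functions within `ε` of `φ` at all times of `D` before `S`. -/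
def tube (D : Set ℝ≥0) (S : ℝ≥0) (φ : ℝ≥0 → ℝ) (ε : ℝ) : Set (ℝ≥0 → ℝ) :=
  {f | ∀ t ∈ D, t < S → |f t - φ t| ≤ ε}

/-- Countability of `D` puts the tube in the product σ-algebra, as needed to apply independence on
path space. -/
theorem measurableSet_tube {D : Set ℝ≥0} (hD : D.Countable) (S : ℝ≥0) (φ : ℝ≥0 → ℝ) (ε : ℝ) :
    MeasurableSet (tube D S φ ε) := by
  have : tube D S φ ε = ⋂ t ∈ D, {f | t < S → |f t - φ t| ≤ ε} := by
    ext f; simp [tube]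
  rw [this]
  refine MeasurableSet.biInter hD fun t _ => ?_
  by_cases ht : t < S
  · simp only [ht, forall_true_left]
    exact measurableSet_le (by fun_prop) measurable_const
  · simp [ht]

/-- A Brownian motion stays close to a given continuous path with positive probability. -/
theorem measure_tube_pos (hX : IsBrownianReal X P) {D : Set ℝ≥0} (hD : D.Countable) (S : ℝ≥0)
    {φ : ℝ≥0 → ℝ} (hφ : Continuous φ) (hφ0 : φ 0 = 0) {ε : ℝ} (hε : 0 < ε) :
    0 < P ((fun ω t => X t ω) ⁻¹' tube D S φ ε) := by
  have := hX.isGaussianProcess.isProbabilityMeasure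
  have hε3 : 0 < ε / 3 := by positivity
  obtain ⟨ρ, hρ, Hφ⟩ := eventually_abs_sub_gridInterp_le hφ S hε3
  set R : ℝ≥0 → Ω → ℝ≥0 → ℝ := fun h ω t => X t ω - gridInterp h (X · ω) t with hR
  obtain ⟨h, hh, hhρ, hpos⟩ : ∃ h : ℝ≥0, 0 < h ∧ (h : ℝ) ≤ ρ ∧
      0 < P (R h ⁻¹' tube D S 0 (ε / 3)) := by
    -- The mesh that works depends on the path. Almost surely some mesh `1 / (k + 1)` works, so
    -- among these countably many one deterministic mesh works with positive probability.
    by_contra! hcon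
    have hnull : P (⋃ k : ℕ, {ω | ((1 / (k + 1) : ℝ≥0) : ℝ) ≤ ρ ∧
        R (1 / (k + 1)) ω ∈ tube D S 0 (ε / 3)}) = 0 := by
      refine measure_iUnion_null fun k => ?_
      by_cases hk : ((1 / (k + 1) : ℝ≥0) : ℝ) ≤ ρ
      · have := hcon _ (by positivity) hk
        rw [nonpos_iff_eq_zero] at this
        exact measure_mono_null (fun ω hω => hω.2) this
      · exact measure_mono_null (fun ω hω => hk hω.1) measure_empty
    have hae : ∀ᵐ ω ∂P, ω ∈ (⋃ k : ℕ, {ω | ((1 / (k + 1) : ℝ≥0) : ℝ) ≤ ρ ∧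
        R (1 / (k + 1)) ω ∈ tube D S 0 (ε / 3)}) := by
      filter_upwards [hX.cont] with ω hω
      obtain ⟨ρ', hρ', H⟩ := eventually_abs_sub_gridInterp_le hω S hε3
      obtain ⟨k, hk⟩ := exists_nat_one_div_lt (lt_min hρ hρ')
      refine Set.mem_iUnion.2 ⟨k, ?_, fun t _ ht => ?_⟩
      · push_cast
        exact hk.le.trans (min_le_left _ _)
      · have := H (1 / (k + 1)) (by positivity)
          (by push_cast; exact hk.le.trans (min_le_right _ _)) t ht.le
        simpa [hR] using this
    have h1 := measure_eq_zero_iff_ae_notMem.1 hnull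
    obtain ⟨ω, h2, h3⟩ := (h1.and hae).exists
    exact h2 h3
  -- The extra node is the right end of the cell containing a time just before `S`.
  have hgrid := measure_grid_pos hX.toIsPreBrownianReal hh (⌊S / h⌋₊ + 1) hφ0 hε3
  set G : Set (ℕ → ℝ) := {c | ∀ k ≤ ⌊S / h⌋₊ + 1, |c k - φ (k * h)| ≤ ε / 3} with hG
  have hGm : MeasurableSet G := by
    have : G = ⋂ k ∈ Set.Iic (⌊S / h⌋₊ + 1), {c : ℕ → ℝ | |c k - φ (k * h)| ≤ ε / 3} := by
      ext c; simp [hG]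
    rw [this]
    exact MeasurableSet.biInter (Set.to_countable _) fun k _ =>
      measurableSet_le (by fun_prop) measurable_const
  have hmul := (indepFun_sub_gridInterp hX.toIsPreBrownianReal hh).measure_inter_preimage_eq_mul
    _ _ (measurableSet_tube hD S 0 (ε / 3)) hGm
  have hpos2 : 0 < P (R h ⁻¹' tube D S 0 (ε / 3) ∩ (fun ω (k : ℕ) => X (k * h) ω) ⁻¹' G) := by
    rw [hmul]
    exact ENNReal.mul_pos hpos.ne' hgrid.ne'
  refine hpos2.trans_le (measure_mono ?_)
  rintro ω ⟨h1, h2⟩ t htD htS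
  have h3 : |R h ω t| ≤ ε / 3 := by simpa using h1 t htD htS
  have h4 := Hφ h hh hhρ t htS.le
  have hfl : ⌊t / h⌋₊ ≤ ⌊S / h⌋₊ := Nat.floor_le_floor (by gcongr)
  have h5 : |gridInterp h (fun s => X s ω - φ s) t| ≤ ε / 3 := by
    refine abs_gridInterp_le hh (h2 _ (by omega)) ?_
    have := h2 (⌊t / h⌋₊ + 1) (by omega)
    push_cast at this
    exact this
  rw [gridInterp_sub] at h5
  simp only [hR] at h3
  rw [abs_le] at *
  constructor <;> linarith [h3.1, h3.2, h4.1, h4.2, h5.1, h5.2]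

end Brownian

/-! ### Support of the vector Wiener process -/

section Wiener

variable {Ω : Type*} [MeasurableSpace Ω] {P : Measure Ω} {n : ℕ} {W : ℝ≥0 → Ω → Vec n}

theorem IsWiener.ae_continuous (hW : IsWiener P W) : ∀ᵐ ω ∂P, Continuous fun t => W t ω := by
  filter_upwards [ae_all_iff.2 fun i => (hW.coord i).cont] with ω hω
  exact (PiLp.continuous_toLp 2 fun _ : Fin n => ℝ).comp (continuous_pi hω)

theorem IsWiener.aemeasurable (hW : IsWiener P W) (t : ℝ≥0) : AEMeasurable (W t) P := by
  have : AEMeasurable (fun ω i => W t ω i) P :=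
    aemeasurable_pi_lambda _ fun i => (hW.coord i).aemeasurable t
  exact (MeasurableEquiv.toLp 2 (Fin n → ℝ)).measurable.comp_aemeasurable this

/-- A Wiener process follows a given continuous path closely with positive probability. -/
theorem IsWiener.measure_close_pos [IsProbabilityMeasure P] (hW : IsWiener P W)
    {φ : ℝ≥0 → Vec n} (hφ : Continuous φ) (hφ0 : φ 0 = 0) (T : ℝ≥0) {ε : ℝ} (hε : 0 < ε) :
    0 < P {ω | (Continuous fun t => W t ω) ∧ ∀ t ≤ T, ‖W t ω - φ t‖ ≤ ε} := by
  obtain ⟨D, hDc, hDd⟩ := TopologicalSpace.exists_countable_dense ℝ≥0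
  set e : ℝ := ε / (n + 1) with he
  have he0 : 0 < e := by positivity
  have hφi : ∀ i, Continuous fun t => φ t i := fun i => by fun_prop
  have hprod := hW.indep.measure_inter_preimage_eq_mul Finset.univ
    (sets := fun i => tube D (T + 1) (fun t => φ t i) e)
    (fun i _ => measurableSet_tube hDc _ _ _)
  have hpos : 0 < P (⋂ i ∈ Finset.univ, (fun ω t => W t ω i) ⁻¹'
      tube D (T + 1) (fun t => φ t i) e) := by
    rw [hprod, pos_iff_ne_zero, Finset.prod_ne_zero_iff]
    exact fun i _ => (measure_tube_pos (hW.coord i) hDc _ (hφi i) (by simp [hφ0]) he0).ne'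
  refine hpos.trans_le (measure_mono_ae ?_)
  filter_upwards [hW.ae_continuous] with ω hc hω
  refine ⟨hc, fun t ht => ?_⟩
  have hcoord : ∀ i, |W t ω i - φ t i| ≤ e := fun i => by
    have h1 := Set.mem_iInter₂.1 hω i (Finset.mem_univ i)
    have hcl : IsClosed {t | |W t ω i - φ t i| ≤ e} :=
      isClosed_le (by fun_prop) continuous_const
    -- The open horizon `T + 1` lets density of `D` and path continuity reach every `t ≤ T`, the
    -- endpoint included.
    have hsub : Set.Iio (T + 1) ∩ D ⊆ {t | |W t ω i - φ t i| ≤ e} := fun s hs => h1 s hs.2 hs.1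
    exact hcl.closure_subset_iff.2 hsub (hDd.open_subset_closure_inter isOpen_Iio
      (lt_of_le_of_lt ht (by simp)))
  rw [EuclideanSpace.norm_eq]
  refine Real.sqrt_le_iff.2 ⟨hε.le, ?_⟩
  calc ∑ i, ‖(W t ω - φ t) i‖ ^ 2 ≤ ∑ _i : Fin n, e ^ 2 := by
        refine Finset.sum_le_sum fun i _ => ?_
        exact pow_le_pow_left₀ (norm_nonneg _) (by simpa using hcoord i) 2
    _ = n * e ^ 2 := by simp
    _ ≤ (n + 1) ^ 2 * e ^ 2 := by
        gcongr
        nlinarith [(Nat.cast_nonneg n : (0 : ℝ) ≤ n)]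
    _ = ε ^ 2 := by rw [he]; field_simp

end Wiener

/-! ### Transition probabilities: measurability, semicontinuity, positivity -/

section Transition

variable {d n : ℕ} {A : Vec d →L[ℝ] Vec d} {F : Vec d → Vec d} {B : Vec n →L[ℝ] Vec d}

/-- The solution depends in a Lipschitz way on the initial point and on the driving path. -/
theorem norm_solution_sub_solution_le {K : ℝ≥0} (hF : LipschitzWith K F) (x x' : Vec d)
    {η η' : ℝ≥0 → Vec n} (hη : Continuous η) (hη' : Continuous η') {T : ℝ≥0} {c : ℝ}
    (h : ∀ t ≤ T, ‖η t - η' t‖ ≤ c) {t : ℝ≥0} (ht : t ≤ T) :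
    ‖solution A F B x η t - solution A F B x' η' t‖
      ≤ (‖x - x'‖ + ‖B‖ * c) * Real.exp ((‖A‖₊ + K : ℝ≥0) * t) := by
  have hs := isSolution_solution (A := A) (B := B) (x := x') ⟨K, hF⟩ hη'
  refine norm_solution_sub_le hF hη hs.1 (g := fun t => (x' - x) - B (η t - η' t))
    (fun t _ => ?_) (fun t ht => ?_) ht
  · rw [hs.2 t, map_sub]; abel_nf
  · refine (norm_sub_le _ _).trans ?_
    rw [norm_sub_rev x' x]
    gcongr
    exact B.le_opNorm_of_le (h t ht)

theorem continuous_solution (hF : ∃ K, LipschitzWith K F) {η : ℝ≥0 → Vec n} (hη : Continuous η) :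
    Continuous fun p : Vec d × ℝ≥0 => solution A F B p.1 η p.2 := by
  obtain ⟨K, hK⟩ := hF
  refine continuous_iff_continuousAt.2 fun p => ?_
  have hs := (isSolution_solution (A := A) (B := B) (x := p.1) ⟨K, hK⟩ hη).1
  have h1 : Filter.Tendsto (fun q : Vec d × ℝ≥0 => solution A F B q.1 η q.2
      - solution A F B p.1 η q.2) (nhds p) (nhds 0) := by
    have hlim : Filter.Tendsto (fun q : Vec d × ℝ≥0 =>
        ‖q.1 - p.1‖ * Real.exp ((‖A‖₊ + K : ℝ≥0) * q.2)) (nhds p) (nhds 0) := by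
      have : Continuous fun q : Vec d × ℝ≥0 =>
        ‖q.1 - p.1‖ * Real.exp ((‖A‖₊ + K : ℝ≥0) * q.2) := by fun_prop
      simpa using this.tendsto p
    refine squeeze_zero_norm (fun q => ?_) hlim
    simpa using norm_solution_sub_solution_le (A := A) (B := B) hK q.1 p.1 hη hη (T := q.2)
      (c := 0) (by simp) le_rfl
  have h2 : Filter.Tendsto (fun q : Vec d × ℝ≥0 => solution A F B p.1 η q.2) (nhds p)
      (nhds (solution A F B p.1 η p.2)) := (hs.comp continuous_snd).tendsto p
  simpa [ContinuousAt] using h1.add h2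

variable {Ω : Type*} [MeasurableSpace Ω] {P : Measure Ω} {W : ℝ≥0 → Ω → Vec n}

/-- Replacing the path by its Bernstein approximation makes the solution a continuous function of
finitely many values of `W`; uniform convergence of the approximations and stability give an almost
sure limit. -/
theorem aemeasurable_solution (hW : IsWiener P W) (hF : ∃ K, LipschitzWith K F) (x : Vec d)
    (T : ℝ≥0) : AEMeasurable (fun ω => solution A F B x (fun t => W t ω) T) P := by
  obtain ⟨K, hK⟩ := hF
  -- Rescaling by `T + 1` rather than `T` stays valid at `T = 0`.
  set σ : ℝ≥0 → unitInterval := fun t => Set.projIcc 0 1 zero_le_one ((t : ℝ) / (T + 1)) with hσ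
  have hσc : Continuous σ := by
    refine continuous_projIcc.comp ?_
    fun_prop
  set r : unitInterval → ℝ≥0 := fun s => (s : ℝ).toNNReal * (T + 1) with hr
  have hrc : Continuous r := by fun_prop
  have hrσ : ∀ t ≤ T, r (σ t) = t := fun t ht => by
    have ht' : (t : ℝ) ≤ T := ht
    have hT : (0 : ℝ) < T + 1 := by positivity
    have h1 : (t : ℝ) / (T + 1) ∈ Set.Icc (0 : ℝ) 1 :=
      ⟨by positivity, by rw [div_le_one hT]; linarith⟩
    simp only [hr, hσ, Set.projIcc_of_mem zero_le_one h1]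
    rw [← NNReal.coe_inj]
    push_cast
    rw [Real.coe_toNNReal _ h1.1]
    field_simp
  let path : (N : ℕ) → (Fin (N + 1) → Vec n) → ℝ≥0 → Vec n := fun N c t =>
    ∑ k : Fin (N + 1), bernstein N k (σ t) • c k
  have hpathc : ∀ N c, Continuous (path N c) := fun N c => by
    simp only [path]
    fun_prop
  have hcont : ∀ N, Continuous fun c => solution A F B x (path N c) T := fun N => by
    refine continuous_iff_continuousAt.2 fun c => ?_
    rw [ContinuousAt, tendsto_iff_norm_sub_tendsto_zero]
    have hlim : Filter.Tendsto (fun c' => (‖x - x‖ + ‖B‖ * ‖c' - c‖) *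
        Real.exp ((‖A‖₊ + K : ℝ≥0) * T)) (nhds c) (nhds 0) := by
      have : Continuous (fun c' => (‖x - x‖ + ‖B‖ * ‖c' - c‖) *
        Real.exp ((‖A‖₊ + K : ℝ≥0) * T)) := by fun_prop
      simpa using this.tendsto c
    refine squeeze_zero (fun _ => norm_nonneg _) (fun c' => ?_) hlim
    refine norm_solution_sub_solution_le hK x x (hpathc N c') (hpathc N c) (fun t _ => ?_) le_rfl
    simp only [path, ← Finset.sum_sub_distrib, ← smul_sub]
    calc ‖∑ k : Fin (N + 1), bernstein N k (σ t) • (c' k - c k)‖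
        ≤ ∑ k : Fin (N + 1), bernstein N k (σ t) * ‖c' - c‖ := by
          refine norm_sum_le_of_le _ fun k _ => ?_
          rw [norm_smul, Real.norm_of_nonneg bernstein_nonneg]
          exact mul_le_mul_of_nonneg_left (norm_le_pi_norm (c' - c) k) bernstein_nonneg
      _ = ‖c' - c‖ := by rw [← Finset.sum_mul, bernstein.probability, one_mul]
  refine aemeasurable_of_tendsto_metrizable_ae' (f := fun N ω =>
    solution A F B x (path N fun k => W (r (bernstein.z k)) ω) T) (fun N => ?_) ?_
  · exact (hcont N).measurable.comp_aemeasurable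
      (aemeasurable_pi_lambda _ fun k => hW.aemeasurable _)
  · filter_upwards [hW.ae_continuous] with ω hω
    let f : C(unitInterval, Vec n) := ⟨fun s => W (r s) ω, hω.comp hrc⟩
    have hf := tendsto_iff_norm_sub_tendsto_zero.1 (bernsteinApproximation_uniform f)
    rw [tendsto_iff_norm_sub_tendsto_zero]
    have hlim : Filter.Tendsto (fun N => (‖x - x‖ + ‖B‖ * ‖bernsteinApproximation N f - f‖) *
        Real.exp ((‖A‖₊ + K : ℝ≥0) * T)) Filter.atTop (nhds 0) := by
      simpa using (hf.const_mul ‖B‖).mul_const (Real.exp ((‖A‖₊ + K : ℝ≥0) * T))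
    refine squeeze_zero (fun _ => norm_nonneg _) (fun N => ?_) hlim
    refine norm_solution_sub_solution_le hK x x (hpathc N _) hω (fun t ht => ?_) le_rfl
    have h1 := (bernsteinApproximation N f - f).norm_coe_le_norm (σ t)
    rw [ContinuousMap.sub_apply, bernsteinApproximation.apply] at h1
    simp only [f, ContinuousMap.coe_mk, hrσ t ht] at h1
    exact h1

theorem transition_apply (hW : IsWiener P W) (hF : ∃ K, LipschitzWith K F) (x : Vec d) (T : ℝ≥0)
    {U : Set (Vec d)} (hU : MeasurableSet U) :
    transition P W A F B T x U = P {ω | solution A F B x (fun t => W t ω) T ∈ U} :=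
  Measure.map_apply_of_aemeasurable (aemeasurable_solution hW hF x T) hU

/-- The transition probabilities of an open set are lower semicontinuous. -/
theorem lowerSemicontinuous_transition (hW : IsWiener P W) (hF : ∃ K, LipschitzWith K F)
    {U : Set (Vec d)} (hU : IsOpen U) :
    LowerSemicontinuous fun p : Vec d × ℝ≥0 => transition P W A F B p.2 p.1 U := by
  simp only [transition_apply hW hF _ _ hU.measurableSet]
  intro p c hc
  -- Paths whose landing in `U` is robust at scale `1 / (k + 1)`. Almost surely every landing is
  -- robust at some scale; continuity from below, which needs no measurability of `E k`, picks one
  -- scale for the mass bound.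
  set E : ℕ → Set Ω := fun k => {ω | ∀ q ∈ Metric.ball p (1 / (k + 1)),
    solution A F B q.1 (fun t => W t ω) q.2 ∈ U} with hE
  have hmono : Monotone E := fun i j hij ω hω q hq =>
    hω q (Metric.ball_subset_ball (Nat.one_div_le_one_div hij) hq)
  have hle : P {ω | solution A F B p.1 (fun t => W t ω) p.2 ∈ U} ≤ P (⋃ k, E k) := by
    refine measure_mono_ae ?_
    filter_upwards [hW.ae_continuous] with ω hω hp
    have hn := (continuous_solution (A := A) (B := B) hF hω).continuousAt.preimage_mem_nhds
      (hU.mem_nhds hp)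
    obtain ⟨ρ, hρ, hb⟩ := Metric.mem_nhds_iff.1 hn
    obtain ⟨k, hk⟩ := exists_nat_one_div_lt hρ
    exact Set.mem_iUnion.2 ⟨k, fun q hq => hb (Metric.ball_subset_ball hk.le hq)⟩
  rw [hmono.measure_iUnion] at hle
  obtain ⟨k, hk⟩ := lt_iSup_iff.1 (hc.trans_le hle)
  filter_upwards [Metric.ball_mem_nhds p (Nat.one_div_pos_of_nat (n := k))] with q hq
  exact hk.trans_le (measure_mono fun ω hω => hω q hq)

/-- The transition probabilities of a ball are positive. -/
theorem transition_ball_pos [IsProbabilityMeasure P] (hW : IsWiener P W)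
    (hF : ∃ K, LipschitzWith K F) {m : ℕ} (hm : kalmanSpan A B m = ⊤) (hG : GrowthCondition F m)
    (x x₀ : Vec d) {T : ℝ≥0} (hT : 0 < T) {δ : ℝ} (hδ : 0 < δ) :
    0 < transition P W A F B T x (Metric.ball x₀ δ) := by
  obtain ⟨η, hη, hη0, hball⟩ := exists_control hF hm hG x x₀ hT hδ
  rw [transition_apply hW hF _ _ measurableSet_ball]
  obtain ⟨K, hK⟩ := hF
  rw [mem_ball_iff_norm] at hball
  set ρ : ℝ := δ - ‖solution A F B x η T - x₀‖ with hρ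
  -- The `+ 1` keeps `M` positive when `B = 0`; tolerance `ρ / (2 * M)` then uses at most half the
  -- margin `ρ`.
  set M : ℝ := (‖B‖ + 1) * Real.exp ((‖A‖₊ + K : ℝ≥0) * T) with hM
  have hρ0 : 0 < ρ := sub_pos.2 hball
  have hM0 : 0 < M := by positivity
  refine (hW.measure_close_pos hη hη0 T (ε := ρ / (2 * M)) (by positivity)).trans_le
    (measure_mono ?_)
  rintro ω ⟨hc, hω⟩
  rw [Set.mem_ofPred_eq, mem_ball_iff_norm]
  have h1 := norm_solution_sub_solution_le (A := A) (B := B) hK x x hc hη hω le_rfl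
  have h2 : (‖x - x‖ + ‖B‖ * (ρ / (2 * M))) * Real.exp ((‖A‖₊ + K : ℝ≥0) * T) < ρ := by
    calc _ ≤ (‖B‖ + 1) * (ρ / (2 * M)) * Real.exp ((‖A‖₊ + K : ℝ≥0) * T) := by
          rw [sub_self, norm_zero, zero_add]
          gcongr
          linarith
      _ = M * (ρ / (2 * M)) := by rw [hM]; ring
      _ = ρ / 2 := by field_simp
      _ < ρ := by linarith
  have h3 := norm_sub_le_norm_sub_add_norm_sub (solution A F B x (fun t => W t ω) T)
    (solution A F B x η T) x₀
  linarith

end Transition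

end LangevinSDE

theorem mainTheorem5 {Ω : Type*} [MeasurableSpace Ω] (P : Measure Ω) [IsProbabilityMeasure P]
    (d n : ℕ) (W : ℝ≥0 → Ω → LangevinSDE.Vec n) (hW : LangevinSDE.IsWiener P W)
    (A : LangevinSDE.Vec d →L[ℝ] LangevinSDE.Vec d)
    (B : LangevinSDE.Vec n →L[ℝ] LangevinSDE.Vec d)
    (F : LangevinSDE.Vec d → LangevinSDE.Vec d)
    (hF_smooth : ContDiff ℝ (⊤ : ℕ∞) F) (hF_lip : ∃ K : ℝ≥0, LipschitzWith K F)
    (hK : LangevinSDE.KalmanCondition A B)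
    (dstar : ℕ) (hdstar : LangevinSDE.kalmanSpan A B dstar = ⊤)
    (hG : LangevinSDE.GrowthCondition F dstar)
    (x₀ : LangevinSDE.Vec d) (δ : ℝ) (hδ : 0 < δ) :
    (∀ (x : LangevinSDE.Vec d) (T : ℝ≥0), 0 < T →
      0 < LangevinSDE.transition P W A F B T x (Metric.ball x₀ δ)) ∧
    LowerSemicontinuous (fun p : LangevinSDE.Vec d × ℝ≥0 =>
      LangevinSDE.transition P W A F B p.2 p.1 (Metric.ball x₀ δ)) := by
  exact ⟨fun x T hT => LangevinSDE.transition_ball_pos hW hF_lip hdstar hG x x₀ hT hδ,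
    LangevinSDE.lowerSemicontinuous_transition hW hF_lip Metric.isOpen_ball⟩
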